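/- Let $G$ be a finite simple undirected graph with at least one vertex, whose edges are colored arbitrarily (adjacent edges may have the same color). Suppose that every vertex of $G$ is incident with at least two differently colored edges. If $G$ has no properly colored closed trail, then $G$ has a bridge. Here a closed trail is a closed walk of positive length without repeated edges (vertices may be repeated); it is properly colored if any two consecutive edges in it, including the last and the first one, have different colors; and a bridge is an edge whose removal increases the number of connected components. -/

import Mathlib

/-- The list of the colors of the edges traversed by a walk, in the order of traversal. The edge
coloring `C` is an arbitrary assignment of colors to the edges. -/
def SimpleGraph.Walk.colorList {V K : Type*} {G : SimpleGraph V} (C : G.EdgeLabeling K)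
    {u v : V} (p : G.Walk u v) : List K :=
  p.darts.map fun d => C ⟨d.edge, d.edge_mem⟩

/-- A properly colored closed trail: a closed walk of positive length without repeated edges
(vertices may repeat) in which any two consecutive edges, the last and the first one included,
have different colors. -/
def SimpleGraph.Walk.IsProperlyColoredClosedTrail {V K : Type*} {G : SimpleGraph V}
    (C : G.EdgeLabeling K) {u : V} (p : G.Walk u u) : Prop :=
  p.IsCircuit ∧ Cycle.Chain (fun a b : K => a ≠ b) (p.colorList C : Cycle K)

/-! Pass to a graph whose vertices are the darts of $G$: reversal of darts is a perfect matching
`m`, and `R` joins darts that leave the same vertex with different colors. Alternating cycles there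
yield properly colored closed trails, so there are none. Kotzig's theorem (`exists_matching_bridge`)
then gives a matching edge that is a bridge. Since the darts at each vertex stay connected through
color changes, that edge is a bridge of $G$.

Kotzig's theorem goes by induction on the number of vertices. Take a longest alternating path,
beginning with a matching edge at `y`. If `y` has no `R`-neighbor, its matching edge is pendant.
Otherwise an `R`-neighbor `v` lies on the path by maximality and closes either an alternating cycle,
which is excluded, or a blossom with base `v`. Contracting the blossom creates no alternating cycle
(`IsBlossom.exists_isAltCycle`), and a bridge of the contraction is a bridge of the original graph.
-/

section
open List

/-! ### Alternating cycles: reversal and rotation -/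

/-- One step of an alternating walk: traverse the matching edge from `a` to `m a`, then follow a
non-matching edge from `m a` to `b`. -/
def AltStep {X : Type*} (m : X → X) (R : X → X → Prop) (a b : X) : Prop := R (m a) b

/-- The matching edges `{a, m a}` and `{b, m b}` are different. -/
def DistinctPairs {X : Type*} (m : X → X) (a b : X) : Prop := a ≠ b ∧ a ≠ m b

/-- The list `a :: l` describes an alternating cycle: every `x` in it stands for the matching edge
`{x, m x}`, traversed from `x` to `m x`. -/
def IsAltCycle {X : Type*} (m : X → X) (R : X → X → Prop) (a : X) (l : List X) : Prop :=
  IsChain (AltStep m R) (a :: (l ++ [a])) ∧ Pairwise (DistinctPairs m) (a :: l)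

variable {X : Type*} {m : X → X} {R : X → X → Prop}

theorem DistinctPairs.symm (hm : m.Involutive) {a b : X} (h : DistinctPairs m a b) :
    DistinctPairs m b a :=
  ⟨h.1.symm, fun e => h.2 (by rw [e, hm])⟩

theorem DistinctPairs.map (hm : m.Involutive) {a b : X} (h : DistinctPairs m a b) :
    DistinctPairs m (m a) (m b) :=
  ⟨fun e => h.1 (hm.injective e), fun e => h.2 (by rw [hm] at e; rw [← e, hm])⟩

theorem AltStep.dual (hm : m.Involutive) (hR : ∀ ⦃x y⦄, R x y → R y x) {a b : X} (h : AltStep m R a b) :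
    AltStep m R (m b) (m a) := by
  unfold AltStep at *
  rw [hm]
  exact hR h

theorem isChain_altStep_dual (hm : m.Involutive) (hR : ∀ ⦃x y⦄, R x y → R y x) {l : List X}
    (h : IsChain (AltStep m R) l) : IsChain (AltStep m R) (l.map m).reverse := by
  rw [isChain_reverse, isChain_map]
  exact h.imp fun a b hab => hab.dual hm hR

theorem pairwise_distinctPairs_dual (hm : m.Involutive) {l : List X}
    (h : Pairwise (DistinctPairs m) l) : Pairwise (DistinctPairs m) (l.map m).reverse := by
  rw [pairwise_reverse, pairwise_map]
  exact h.imp fun hab => (hab.map hm).symm hm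

theorem IsAltCycle.dual (hm : m.Involutive) (hR : ∀ ⦃x y⦄, R x y → R y x) {a : X} {l : List X}
    (h : IsAltCycle m R a l) : IsAltCycle m R (m a) (l.map m).reverse := by
  refine ⟨by simpa using isChain_altStep_dual hm hR h.1, ?_⟩
  have := pairwise_distinctPairs_dual hm h.2
  rw [map_cons, reverse_cons, pairwise_append_comm fun hab => hab.symm hm] at this
  simpa using this

theorem IsAltCycle.exists_rotate (hm : m.Involutive) {a u : X} {l : List X}
    (h : IsAltCycle m R a l) (hu : u ∈ a :: l) : ∃ l', IsAltCycle m R u l' := by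
  rcases mem_cons.1 hu with rfl | hu
  · exact ⟨l, h⟩
  obtain ⟨p, q, rfl⟩ := append_of_mem hu
  refine ⟨q ++ a :: p, ?_, ?_⟩
  · have h1 := h.1
    have e1 : a :: ((p ++ u :: q) ++ [a]) = (a :: p) ++ u :: (q ++ [a]) := by simp
    have e2 : u :: ((q ++ a :: p) ++ [u]) = (u :: q) ++ a :: (p ++ [u]) := by simp
    rw [e1, isChain_split] at h1
    rw [e2, isChain_split]
    exact ⟨h1.2, h1.1⟩
  · have h2 := h.2
    rw [← cons_append, pairwise_append_comm fun hab => hab.symm hm] at h2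
    simpa using h2

theorem List.IsChain.exists_rel_left {r : X → X → Prop} {x : X} :
    ∀ {l : List X} {a : X}, IsChain r (a :: l) → x ∈ l → ∃ z, r z x
  | b :: l, a, h, hx => by
    rw [isChain_cons_cons] at h
    rcases mem_cons.1 hx with rfl | hx
    · exact ⟨a, h.1⟩
    · exact h.2.exists_rel_left hx

theorem IsAltCycle.exists_rel_left {a x : X} {l : List X} (h : IsAltCycle m R a l)
    (hx : x ∈ a :: l) : ∃ z, R z x := by
  obtain ⟨z, hz⟩ := h.1.exists_rel_left (x := x) (by simpa [or_comm] using hx)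
  exact ⟨_, hz⟩

/-! ### Blossoms and their contraction -/

open Classical in
/-- The map contracting to `b` the vertices of the matching edges in `p`. -/
noncomputable def blossomMap (m : X → X) (b : X) (p : List X) (x : X) : X :=
  if x ∈ p ∨ m x ∈ p then b else x

/-- The relation obtained from `R` by contracting a blossom, with loops removed. -/
def contractRel (m : X → X) (R : X → X → Prop) (b : X) (p : List X) (x y : X) : Prop :=
  x ≠ y ∧ ∃ x' y', R x' y' ∧ blossomMap m b p x' = x ∧ blossomMap m b p y' = y

/-- A blossom with base `b`: an alternating walk which leaves the base, runs through the matching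
edges in `p`, and returns to the base. -/
def IsBlossom (m : X → X) (R : X → X → Prop) (b : X) (p : List X) : Prop :=
  IsChain (AltStep m R) (m b :: (p ++ [b])) ∧ Pairwise (DistinctPairs m) (p ++ [b])

theorem blossomMap_eq_self_or {b : X} {p : List X} (x : X) :
    (blossomMap m b p x = x ∧ ¬ (x ∈ p ∨ m x ∈ p)) ∨
      (blossomMap m b p x = b ∧ (x ∈ p ∨ m x ∈ p)) := by
  unfold blossomMap
  split_ifs with h
  · exact .inr ⟨rfl, h⟩
  · exact .inl ⟨rfl, h⟩

/-- Both ends of the walk are attached at the base. Running backwards supplies the second direction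
in which `IsBlossom.exists_path` needs to traverse a matching edge. -/
theorem IsBlossom.dual (hm : m.Involutive) (hR : ∀ ⦃x y⦄, R x y → R y x) {b : X} {p : List X}
    (h : IsBlossom m R b p) : IsBlossom m R b (p.map m).reverse := by
  refine ⟨by simpa [hm b] using isChain_altStep_dual hm hR h.1, ?_⟩
  have h2 := h.2
  simp only [pairwise_append, pairwise_cons, mem_singleton, forall_eq] at h2 ⊢
  refine ⟨pairwise_distinctPairs_dual hm h2.1, by simp, ?_⟩
  simp only [mem_reverse, mem_map, forall_exists_index, and_imp, forall_apply_eq_imp_iff₂]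
  exact fun a ha => ⟨fun e => (h2.2.2 a ha).2 (by rw [← e, hm]),
    fun e => (h2.2.2 a ha).1 (hm.injective e)⟩

theorem IsBlossom.not_mem {b : X} {p : List X}
    (h : IsBlossom m R b p) : ¬ (b ∈ p ∨ m b ∈ p) := by
  have h2 := (pairwise_append.1 h.2).2.2
  rintro (hb | hb)
  · exact (h2 b hb b (by simp)).1 rfl
  · exact (h2 _ hb b (by simp)).2 rfl

theorem IsBlossom.exists_path_of_map_mem {b t : X} {p : List X}
    (h : IsBlossom m R b p) (ht : m t ∈ p) :
    ∃ s, IsChain (AltStep m R) (m b :: (s ++ [m t])) ∧ Pairwise (DistinctPairs m) (s ++ [m t]) ∧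
      ∀ x ∈ s ++ [m t], x ∈ p ∨ m x ∈ p := by
  obtain ⟨s, q, rfl⟩ := append_of_mem ht
  refine ⟨s, ?_, ?_, ?_⟩
  · have h1 := h.1
    have e : m b :: ((s ++ m t :: q) ++ [b]) = (m b :: s) ++ m t :: (q ++ [b]) := by simp
    rw [e, isChain_split] at h1
    exact h1.1
  · refine h.2.sublist ?_
    simp
  · intro x hx
    simp at hx ⊢
    tauto

/-- From the base of a blossom every vertex of the blossom is reached by an alternating path that
ends with a matching edge. -/
theorem IsBlossom.exists_path (hm : m.Involutive) (hR : ∀ ⦃x y⦄, R x y → R y x) {b t : X} {p : List X}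
    (h : IsBlossom m R b p) (ht : t ∈ p ∨ m t ∈ p) :
    ∃ s, IsChain (AltStep m R) (m b :: (s ++ [m t])) ∧ Pairwise (DistinctPairs m) (s ++ [m t]) ∧
      ∀ x ∈ s ++ [m t], x ∈ p ∨ m x ∈ p := by
  rcases ht with ht | ht
  · obtain ⟨s, h1, h2, h3⟩ := (h.dual hm hR).exists_path_of_map_mem (t := t)
      (by simpa using ⟨t, ht, rfl⟩)
    refine ⟨s, h1, h2, fun x hx => ?_⟩
    have := h3 x hx
    simp only [mem_reverse, mem_map] at this
    rcases this with ⟨y, hy, rfl⟩ | ⟨y, hy, e⟩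
    · exact .inr (by rwa [hm])
    · exact .inl (by rwa [← hm.injective e])
  · exact h.exists_path_of_map_mem ht

theorem contractRel_symm (hR : ∀ ⦃x y⦄, R x y → R y x) {b : X} {p : List X} :
    ∀ ⦃x y⦄, contractRel m R b p x y → contractRel m R b p y x := by
  rintro x y ⟨hne, x', y', h, hx, hy⟩
  exact ⟨hne.symm, y', x', hR h, hy, hx⟩

theorem contractRel.of_ne {b : X} {p : List X} {x y : X} (h : contractRel m R b p x y)
    (hx : x ≠ b) (hy : y ≠ b) : R x y := by
  obtain ⟨-, x', y', h, hx', hy'⟩ := h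
  have h1 := blossomMap_eq_self_or (m := m) (b := b) (p := p) x'
  have h2 := blossomMap_eq_self_or (m := m) (b := b) (p := p) y'
  grind

theorem contractRel.not_mem {b : X} {p : List X} (hb : IsBlossom m R b p)
    {x y : X} (h : contractRel m R b p x y) : ¬ (y ∈ p ∨ m y ∈ p) := by
  obtain ⟨-, x', y', h, hx', hy'⟩ := h
  have h2 := blossomMap_eq_self_or (m := m) (b := b) (p := p) y'
  have := hb.not_mem
  grind

theorem contractRel.of_base {b : X} {p : List X} {y : X} (h : contractRel m R b p b y) :
    ∃ t, (t = b ∨ t ∈ p ∨ m t ∈ p) ∧ R t y := by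
  obtain ⟨hne, x', y', h, hx', hy'⟩ := h
  have h1 := blossomMap_eq_self_or (m := m) (b := b) (p := p) x'
  have h2 := blossomMap_eq_self_or (m := m) (b := b) (p := p) y'
  exact ⟨x', by grind, by grind⟩

/-- An alternating cycle of the contraction that enters the base of the blossom along its matching
edge lifts. -/
theorem IsBlossom.exists_isAltCycle_of_base (hm : m.Involutive) (hR : ∀ ⦃x y⦄, R x y → R y x)
    {b : X} {p : List X} (hb : IsBlossom m R b p) (hfix : m b ≠ b) {l : List X}
    (h : IsAltCycle m (contractRel m R b p) (m b) l) : ∃ a l, IsAltCycle m R a l := by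
  have hl : ∀ x ∈ l, x ≠ b ∧ m x ≠ b := fun x hx => by
    have := (pairwise_cons.1 h.2).1 x hx
    exact ⟨fun e => this.2 (by rw [e]), fun e => this.1 (by rw [← e, hm])⟩
  have hlp : ∀ x ∈ m b :: l, ¬ (x ∈ p ∨ m x ∈ p) := fun x hx => by
    obtain ⟨z, hz⟩ := h.exists_rel_left hx
    exact hz.not_mem hb
  obtain ⟨y, l', hy⟩ : ∃ y l', l ++ [m b] = y :: l' := by
    cases l <;> simp
  have hyb : ∀ x ∈ l ++ [m b], x ≠ b := by
    intro x hx
    rcases mem_append.1 hx with hx | hx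
    · exact (hl x hx).1
    · simpa using (mem_singleton.1 hx) ▸ hfix
  have h1 := h.1
  rw [hy, isChain_cons_cons] at h1
  have hchain : IsChain (AltStep m R) (l ++ [m b]) := by
    have h2 : IsChain (AltStep m (contractRel m R b p)) (l ++ [m b]) := hy ▸ h1.2
    rw [isChain_iff_getElem] at h2 ⊢
    intro i hi
    refine (h2 i hi).of_ne ?_ (hyb _ (getElem_mem _))
    have hi' : i < l.length := by simpa using hi
    rw [getElem_append_left hi']
    exact (hl _ (getElem_mem _)).2
  have hfirst := h1.1
  unfold AltStep at hfirst
  rw [hm] at hfirst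
  obtain ⟨t, ht, hty⟩ := hfirst.of_base
  -- The edge leaving the contracted base starts at some `t` in the blossom. If `t` is not the base,
  -- an alternating path from the base to `t` is inserted; it is disjoint from the rest, since the
  -- contracted cycle avoids `p`.
  rcases ht with rfl | ht
  · refine ⟨m t, l, ?_, h.2⟩
    rw [hy, isChain_cons_cons]
    exact ⟨by unfold AltStep; rwa [hm], hy ▸ hchain⟩
  · obtain ⟨s, hs1, hs2, hs3⟩ := hb.exists_path hm hR ht
    refine ⟨m b, s ++ m t :: l, ?_, ?_⟩
    · have e : m b :: ((s ++ m t :: l) ++ [m b]) = (m b :: s) ++ m t :: (l ++ [m b]) := by simp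
      rw [e, isChain_split]
      refine ⟨by simpa using hs1, ?_⟩
      rw [hy, isChain_cons_cons]
      exact ⟨by unfold AltStep; rwa [hm], hy ▸ hchain⟩
    · have key : ∀ x ∈ s ++ [m t], ∀ y ∈ m b :: l, DistinctPairs m x y := by
        intro x hx y hy
        have h1 := hs3 x hx
        have h2 := hlp y hy
        refine ⟨by rintro rfl; exact h2 h1, by rintro rfl; rw [hm] at h1; exact h2 h1.symm⟩
      have e : s ++ m t :: l = (s ++ [m t]) ++ l := by simp
      rw [e, pairwise_cons, pairwise_append]
      have hp := pairwise_cons.1 h.2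
      refine ⟨fun x hx => ?_, hs2, hp.2, fun x hx y hy => key x hx y (by simp [hy])⟩
      rcases mem_append.1 hx with hx | hx
      · exact (key x hx _ (by simp)).symm hm
      · exact hp.1 x hx

/-- Rotation, and reversal if needed, brings a cycle through the matching edge of the base into the
form already treated; any other cycle uses only edges of `R`. -/
theorem IsBlossom.exists_isAltCycle (hm : m.Involutive) (hR : ∀ ⦃x y⦄, R x y → R y x)
    {b : X} {p : List X} (hb : IsBlossom m R b p) (hfix : m b ≠ b) {a : X} {l : List X}
    (h : IsAltCycle m (contractRel m R b p) a l) : ∃ a l, IsAltCycle m R a l := by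
  by_cases h1 : m b ∈ a :: l
  · obtain ⟨l', h'⟩ := h.exists_rotate hm h1
    exact hb.exists_isAltCycle_of_base hm hR hfix h'
  by_cases h2 : b ∈ a :: l
  · obtain ⟨l', h'⟩ := h.exists_rotate hm h2
    exact hb.exists_isAltCycle_of_base hm hR hfix (h'.dual hm (contractRel_symm hR))
  refine ⟨a, l, h.1.imp_of_mem_imp ?_, h.2⟩
  intro x y hx hy hxy
  have hx' : x ∈ a :: l := by simpa [or_comm] using hx
  have hy' : y ∈ a :: l := by simpa [or_comm] using hy
  exact contractRel.of_ne (x := m x) hxy (fun e => h1 (by rw [← e, hm]; exact hx')) (fun e => h2 (e ▸ hy'))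

/-! ### Kotzig's theorem -/

/-- Adjacency in the graph with edges `R` and the matching `m`, with the edge `{x, m x}` removed. -/
def AdjAvoiding (m : X → X) (R : X → X → Prop) (x a b : X) : Prop :=
  R a b ∨ (b = m a ∧ DistinctPairs m a x)

/-- A matching edge lies either wholly inside `p`, where it collapses, or wholly outside, where it
is unchanged. -/
theorem reflTransGen_contractRel (hm : m.Involutive)
    {b : X} {p : List X} {x u v : X}
    (h : Relation.ReflTransGen (AdjAvoiding m R x) u v) :
    Relation.ReflTransGen (AdjAvoiding m (contractRel m R b p) x)
      (blossomMap m b p u) (blossomMap m b p v) := by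
  induction h with
  | refl => exact .refl
  | @tail v w _ hvw ih =>
    refine ih.trans ?_
    by_cases hne : blossomMap m b p v = blossomMap m b p w
    · rw [hne]
    refine .single ?_
    rcases hvw with hvw | ⟨rfl, hvx⟩
    · exact .inl ⟨hne, v, w, hvw, rfl, rfl⟩
    · have h1 := blossomMap_eq_self_or (m := m) (b := b) (p := p) v
      have h2 := blossomMap_eq_self_or (m := m) (b := b) (p := p) (m v)
      rw [hm] at h2
      right
      rcases h1 with h1 | h1 <;> rcases h2 with h2 | h2
      · rw [h1.1, h2.1]; exact ⟨rfl, hvx⟩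
      · exact absurd h2.2.symm h1.2
      · exact absurd h1.2.symm h2.2
      · exact absurd (h1.1.trans h2.1.symm) hne

theorem List.Pairwise.nodup_of_distinctPairs {l : List X} (h : Pairwise (DistinctPairs m) l) :
    l.Nodup := h.imp fun hab => hab.1

/-- **Kotzig's theorem**: a nonempty finite graph without alternating cycles with respect to a
perfect matching `m` has a bridge that belongs to the matching. -/
theorem exists_matching_bridge (hm : m.Involutive) (S : Finset X) :
    ∀ R : X → X → Prop, S.Nonempty → (∀ x ∈ S, m x ∈ S) → (∀ x ∈ S, m x ≠ x) → (∀ ⦃x y⦄, R x y → R y x) →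
      (∀ x, ¬ R x x) → (∀ x y, R x y → y ∈ S) → (∀ a l, ¬ IsAltCycle m R a l) →
      ∃ x ∈ S, ¬ Relation.ReflTransGen (AdjAvoiding m R x) x (m x) := by
  classical
  induction hn : S.card using Nat.strong_induction_on generalizing S with
  | _ n ih =>
  intro R ⟨x₀, hx₀⟩ hmS hfix hR hirr hRS hno
  -- The possible lengths of alternating paths, bounded by `S.card` because the entries are
  -- distinct.
  let P : ℕ → Prop := fun k => ∃ l : List X, l.length = k ∧ l ≠ [] ∧ (∀ x ∈ l, x ∈ S) ∧
    IsChain (AltStep m R) l ∧ Pairwise (DistinctPairs m) l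
  obtain ⟨k, ⟨l, hlen, hne, hlS, hch, hpw⟩, hmax⟩ : ∃ k, P k ∧ ∀ j, P j → j ≤ k := by
    have hbd : ∀ j, P j → j ≤ S.card := by
      rintro j ⟨l, rfl, -, hlS, -, hpw⟩
      rw [← toFinset_card_of_nodup hpw.nodup_of_distinctPairs]
      exact Finset.card_le_card fun x hx => hlS x (by simpa using hx)
    have hP : P 1 := ⟨[x₀], by simp [hx₀]⟩
    exact ⟨Nat.findGreatest P S.card, Nat.findGreatest_spec (hbd 1 hP) hP,
      fun j hj => Nat.le_findGreatest (hbd j hj) hj⟩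
  obtain ⟨y, l₀, rfl⟩ := exists_cons_of_ne_nil hne
  have hyS : y ∈ S := hlS y (by simp)
  by_cases hleaf : ∃ v, R v y
  swap
  · refine ⟨y, hyS, fun h => ?_⟩
    rcases h.cases_head with h | ⟨c, h | ⟨-, h⟩, -⟩
    · exact hfix y hyS h.symm
    · exact hleaf ⟨c, hR h⟩
    · exact h.1 rfl
  obtain ⟨v, hv⟩ := hleaf
  have hvS : v ∈ S := hRS _ _ (hR hv)
  -- The path traverses `m v` towards `v`, so the edge from `v` back to `y` closes an alternating
  -- cycle.
  by_cases hmv : m v ∈ y :: l₀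
  · exfalso
    obtain ⟨p, q, hpq⟩ := append_of_mem hmv
    rw [hpq, isChain_split] at hch
    rw [hpq] at hpw
    have hpw' : Pairwise (DistinctPairs m) (p ++ [m v]) := hpw.sublist (by simp)
    obtain ⟨r, hr⟩ : ∃ r, p ++ [m v] = y :: r := by
      cases p <;> simp at hpq ⊢ <;> exact hpq.1.symm
    have hr' : IsChain (AltStep m R) (m v :: (p ++ [m v])) := by
      rw [hr, isChain_cons_cons]
      exact ⟨by unfold AltStep; rwa [hm], hr ▸ hch.1⟩
    refine hno (m v) p ⟨hr', ?_⟩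
    rw [pairwise_append_comm fun hab => hab.symm hm] at hpw'
    simpa using hpw'
  by_cases hvl : v ∈ y :: l₀
  swap
  -- Prepending `m v` would give a longer path.
  · exfalso
    have := hmax (l₀.length + 2) ⟨m v :: y :: l₀, by simp, by simp, ?_, ?_, ?_⟩
    · simp at hlen; omega
    · intro x hx
      rcases mem_cons.1 hx with rfl | hx
      · exact hmS v hvS
      · exact hlS x hx
    · rw [isChain_cons_cons]
      exact ⟨by unfold AltStep; rwa [hm], hch⟩
    · rw [pairwise_cons]
      exact ⟨fun x hx => ⟨fun e => hmv (e ▸ hx), fun e => hvl (hm.injective e ▸ hx)⟩, hpw⟩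
  obtain ⟨p, q, hpq⟩ := append_of_mem hvl
  obtain ⟨p', rfl⟩ : ∃ p', p = y :: p' := by
    cases p with
    | nil =>
      simp at hpq
      exact absurd (hpq.1 ▸ hv) (hirr _)
    | cons z p' => simp at hpq; exact ⟨p', by rw [hpq.1]⟩
  rw [hpq] at hch hpw hlS
  rw [isChain_split] at hch
  have hb : IsBlossom m R v (y :: p') := by
    refine ⟨?_, hpw.sublist (by simp)⟩
    rw [cons_append, isChain_cons_cons]
    exact ⟨by unfold AltStep; rwa [hm], hch.1⟩
  have hpS : ∀ x, (x ∈ y :: p' ∨ m x ∈ y :: p') → x ∈ S := by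
    rintro x (hx | hx)
    · exact hlS x (mem_append_left _ hx)
    · rw [← hm x]
      exact hmS _ (hlS _ (mem_append_left _ hx))
  -- The base survives contraction while `y` disappears, so the vertex set shrinks but stays
  -- nonempty.
  let T := S.filter fun x => ¬ (x ∈ y :: p' ∨ m x ∈ y :: p')
  have hTS : T ⊆ S := Finset.filter_subset _ _
  have hvT : v ∈ T := Finset.mem_filter.2 ⟨hvS, hb.not_mem⟩
  have hcard : T.card < n := hn ▸ Finset.card_lt_card
    ⟨hTS, fun h => (Finset.mem_filter.1 (h hyS)).2 (by simp)⟩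
  have hmT : ∀ x ∈ T, m x ∈ T := by
    intro x hx
    have := Finset.mem_filter.1 hx
    exact Finset.mem_filter.2 ⟨hmS x this.1, by rw [hm]; exact fun h => this.2 h.symm⟩
  obtain ⟨x, hx, hbr⟩ := ih _ hcard T rfl (contractRel m R v (y :: p')) ⟨v, hvT⟩ hmT
    (fun x hx => hfix x (hTS hx)) (contractRel_symm hR) (fun x h => h.1 rfl) (by
      intro a c hac
      refine Finset.mem_filter.2 ⟨?_, hac.not_mem hb⟩
      obtain ⟨-, a', c', h, -, rfl⟩ := hac
      rcases blossomMap_eq_self_or (m := m) (b := v) (p := y :: p') c' with h' | h'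
      · rw [h'.1]; exact hRS _ _ h
      · rw [h'.1]; exact hvS)
    (fun a l h => by
      obtain ⟨a', l', h'⟩ := hb.exists_isAltCycle hm hR (hfix v hvS) h
      exact hno a' l' h')
  refine ⟨x, hTS hx, fun h => hbr ?_⟩
  have := reflTransGen_contractRel (b := v) (p := y :: p') hm h
  have hfx : ∀ z ∈ T, blossomMap m v (y :: p') z = z := fun z hz =>
    if_neg (Finset.mem_filter.1 hz).2
  rwa [hfx x hx, hfx _ (hmT x hx)] at this

end

/-! ### The graph of darts -/

section
variable {V K : Type*} {G : SimpleGraph V} (C : G.EdgeLabeling K)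

/-- Two darts with the same initial vertex and differently colored edges. -/
def ColorChange (d e : G.Dart) : Prop :=
  d.fst = e.fst ∧ C ⟨d.edge, d.edge_mem⟩ ≠ C ⟨e.edge, e.edge_mem⟩

theorem ColorChange.symm ⦃d e : G.Dart⦄ (h : ColorChange C d e) : ColorChange C e d :=
  ⟨h.1.symm, h.2.symm⟩

theorem altStep_colorChange_iff {d e : G.Dart} :
    AltStep SimpleGraph.Dart.symm (ColorChange C) d e ↔
      G.DartAdj d e ∧ C ⟨d.edge, d.edge_mem⟩ ≠ C ⟨e.edge, e.edge_mem⟩ := by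
  simp [AltStep, ColorChange, SimpleGraph.DartAdj]

/-- Alternating cycles of darts are properly colored closed trails. -/
theorem IsAltCycle.exists_isProperlyColoredClosedTrail {d : G.Dart} {l : List G.Dart}
    (h : IsAltCycle SimpleGraph.Dart.symm (ColorChange C) d l) :
    ∃ (u : V) (p : G.Walk u u), p.IsProperlyColoredClosedTrail C := by
  have hch : List.IsChain G.DartAdj (d :: (l ++ [d])) :=
    h.1.imp fun _ _ hab => ((altStep_colorChange_iff C).1 hab).1
  have hch' : List.IsChain G.DartAdj (d :: l) := by
    rw [← List.cons_append, List.isChain_append] at hch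
    exact hch.1
  have hclosed : ((d :: l).getLast (by simp)).snd = d.fst := by
    rw [← List.cons_append, List.isChain_append] at hch
    exact hch.2.2 _ (List.getLast_mem_getLast? _) d (by simp)
  obtain ⟨p, hp⟩ : ∃ p : G.Walk d.fst d.fst, p.darts = d :: l :=
    ⟨(SimpleGraph.Walk.ofDarts (d :: l) (by simp) hch').copy rfl hclosed,
      (SimpleGraph.Walk.darts_copy _ _ _).trans (SimpleGraph.Walk.darts_ofDarts _ _)⟩
  refine ⟨d.fst, p, ⟨⟨⟨?_⟩, ?_⟩, ?_⟩⟩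
  · rw [SimpleGraph.Walk.edges, hp, List.Nodup, List.pairwise_map]
    refine h.2.imp fun hab e => ?_
    rcases SimpleGraph.dart_edge_eq_iff _ _ |>.1 e with e | e
    · exact hab.1 e
    · exact hab.2 e
  · rintro rfl
    simp at hp
  · let g : G.Dart → K := fun d => C ⟨d.edge, d.edge_mem⟩
    have hg : p.colorList C = g d :: l.map g := congrArg (List.map g) hp
    have e : g d :: (l.map g ++ [g d]) = (d :: (l ++ [d])).map g := by simp
    rw [hg, Cycle.chain_coe_cons, e, List.isChain_map]
    exact h.1.imp fun _ _ hab => ((altStep_colorChange_iff C).1 hab).2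

/-- If every vertex sees two colors, then the darts leaving a vertex are connected through color
changes. -/
theorem reflTransGen_of_fst_eq
    (hdeg : ∀ v : V, ∃ e f : G.edgeSet,
      v ∈ (e : Sym2 V) ∧ v ∈ (f : Sym2 V) ∧ C e ≠ C f) (x : G.Dart) {d e : G.Dart}
    (h : d.fst = e.fst) :
    Relation.ReflTransGen (AdjAvoiding SimpleGraph.Dart.symm (ColorChange C) x) d e := by
  by_cases hc : C ⟨d.edge, d.edge_mem⟩ = C ⟨e.edge, e.edge_mem⟩
  swap
  · exact .single (.inl ⟨h, hc⟩)
  obtain ⟨f, hf, hne⟩ : ∃ f : G.Dart, f.fst = d.fst ∧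
      C ⟨f.edge, f.edge_mem⟩ ≠ C ⟨d.edge, d.edge_mem⟩ := by
    have key : ∀ a : G.edgeSet, d.fst ∈ (a : Sym2 V) →
        ∃ f : G.Dart, f.fst = d.fst ∧ C ⟨f.edge, f.edge_mem⟩ = C a := by
      rintro ⟨a, ha⟩ hda
      obtain ⟨w, rfl⟩ := Sym2.mem_iff_exists.1 hda
      exact ⟨⟨(d.fst, w), ha⟩, rfl, rfl⟩
    obtain ⟨a, b, ha, hb, hab⟩ := hdeg d.fst
    obtain ⟨f, hf, hfa⟩ := key a ha
    obtain ⟨g, hg, hgb⟩ := key b hb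
    by_cases hfd : C ⟨f.edge, f.edge_mem⟩ = C ⟨d.edge, d.edge_mem⟩
    · exact ⟨g, hg, fun e => hab (by rw [← hfa, ← hgb, hfd, e])⟩
    · exact ⟨f, hf, hfd⟩
  exact .tail (.single (.inl ⟨hf.symm, hne.symm⟩)) (.inl ⟨hf.trans h, by rwa [← hc]⟩)

end

theorem mainTheorem3 {V : Type*} [Finite V] [Nonempty V] {K : Type*}
    (G : SimpleGraph V) (C : G.EdgeLabeling K)
    (hdeg : ∀ v : V, ∃ e f : G.edgeSet,
      v ∈ (e : Sym2 V) ∧ v ∈ (f : Sym2 V) ∧ C e ≠ C f)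
    (hacyc : ¬ ∃ (u : V) (p : G.Walk u u), p.IsProperlyColoredClosedTrail C) :
    ∃ e ∈ G.edgeSet, G.IsBridge e := by
  classical
  have : Fintype V := Fintype.ofFinite V
  have : Nonempty G.Dart := by
    obtain ⟨v⟩ := ‹Nonempty V›
    obtain ⟨⟨e, he⟩, -⟩ := hdeg v
    induction e with | _ a b => exact ⟨⟨(a, b), he⟩⟩
  obtain ⟨x, -, hx⟩ := exists_matching_bridge SimpleGraph.Dart.symm_involutive
    (Finset.univ : Finset G.Dart) (ColorChange C) Finset.univ_nonempty (by simp)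
    (fun d _ => d.symm_ne) (ColorChange.symm C) (fun d h => h.2 rfl) (by simp)
    (fun _ _ h => hacyc (h.exists_isProperlyColoredClosedTrail C))
  refine ⟨x.edge, x.edge_mem, ?_⟩
  change G.IsBridge s(x.fst, x.snd)
  rw [SimpleGraph.isBridge_iff, SimpleGraph.reachable_iff_reflTransGen]
  intro h
  refine hx ?_
  -- The claim covers all darts leaving `w`: an edge of $G$ other than that of `x` is crossed by a
  -- permitted matching edge, then color changes reach every dart at its end. The case needed is
  -- `x.symm`.
  suffices key : ∀ w, Relation.ReflTransGen (G.deleteEdges {s(x.fst, x.snd)}).Adj x.fst w →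
      ∀ d : G.Dart, d.fst = w →
      Relation.ReflTransGen (AdjAvoiding SimpleGraph.Dart.symm (ColorChange C) x) x d from
    key _ h _ rfl
  clear h
  intro w h
  induction h with
  | refl => exact fun d hd => reflTransGen_of_fst_eq C hdeg x hd.symm
  | @tail v w _ hvw ih =>
    intro d hd
    rw [SimpleGraph.deleteEdges_adj] at hvw
    let f : G.Dart := ⟨(v, w), hvw.1⟩
    have hf : f.edge ≠ x.edge := hvw.2
    refine ((ih f rfl).tail (.inr ⟨rfl, ?_, ?_⟩)).trans
      (reflTransGen_of_fst_eq C hdeg x hd.symm)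
    · exact fun e => hf (by rw [e])
    · exact fun e => hf (by rw [e, SimpleGraph.Dart.edge_symm])
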